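/- Let $\mathcal{A}$ be a finite alphabet with $n=\#\mathcal{A}$ letters. A \emph{pair} on $\mathcal{A}$ is $\mathbf{p}=(p_0,p_1)$, where $p_0,p_1:\mathcal{A}\to\{1,\dots,n\}$ are bijections; it is written as two rows, row $\varepsilon\in\{0,1\}$ being the word $p_\varepsilon^{-1}(1)\,p_\varepsilon^{-1}(2)\cdots p_\varepsilon^{-1}(n)$. The pair is \emph{irreducible} if, for $1\le k\le n$, $p_0^{-1}\{1,\dots,k\}=p_1^{-1}\{1,\dots,k\}$ holds exactly when $k=n$; it is \emph{standard} if it is irreducible, $p_0^{-1}(1)=p_1^{-1}(n)$ and $p_1^{-1}(1)=p_0^{-1}(n)$. For $\varepsilon\in\{0,1\}$, the \emph{Rauzy move} of type $\varepsilon$ sends an irreducible pair $\mathbf{p}$ to the irreducible pair $\mathbf{p}'$ with $p'_\varepsilon=p_\varepsilon$ and, with $z=p_\varepsilon^{-1}(n)$ and $m=p_{1-\varepsilon}(z)$, $$p'_{1-\varepsilon}(b)=\begin{cases}p_{1-\varepsilon}(b), & p_{1-\varepsilon}(b)\le m,\\ p_{1-\varepsilon}(b)+1, & m<p_{1-\varepsilon}(b)<n,\\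 m+1, & p_{1-\varepsilon}(b)=n \text{ and } m<n.\end{cases}$$ The \emph{labeled Rauzy class} of an irreducible pair $\mathbf{p}$ is its class under the smallest equivalence relation on irreducible pairs on $\mathcal{A}$ in which every pair is equivalent to its images under the Rauzy moves of both types. Let $\mathbf{p}$ be a standard pair and let $b,c\in\mathcal{A}$ satisfy $1<p_\varepsilon(b)<p_\varepsilon(c)<n$ for $\varepsilon=0,1$. Then the two rows of $\mathbf{p}$ can be written with (possibly empty) words $w_1,\dots,w_6$ and letters $a,z$ as $$a\,w_1\,b\,w_2\,c\,w_3\,z\qquad\text{and}\qquad z\,w_4\,b\,w_5\,c\,w_6\,a,$$ and the \emph{$\{b,c\}$-inner switch move} sends $\mathbf{p}$ to the standard pair with rows $$a\,w_2\,c\,w_1\,b\,w_3\,z\qquad\text{and}\qquad z\,w_5\,c\,w_4\,b\,w_6\,a.$$ \textbf{Proposition.} Let $\mathbf{p}$ and $\mathbf{r}$ be distinct standard pairs on $\mathcal{A}$. Then $\mathbf{p}$ and $\mathbf{r}$ lie in the same labeled Rauzy class if and only if there is a finite sequence of inner switch moves leading from $\mathbf{p}$ to $\mathbf{r}$. -/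

import Mathlib

/-!
Pairs (labeled permutations), irreducible and standard pairs, Rauzy moves, labeled Rauzy
classes and inner switch moves. Rows are indexed by `ε : Fin 2`, and `1 - ε` is the other row.
Positions in a row are numbered from `1`, as usual.
-/

/-- A pair `p = (p₀, p₁)` on the finite alphabet `A`: each row `p_ε` is a bijection from `A`
onto `{1, …, #A}`. -/
@[ext]
structure Pair (A : Type*) [Fintype A] where
  row : Fin 2 → A → ℕ
  bijOn : ∀ ε, Set.BijOn (row ε) Set.univ (Set.Icc 1 (Fintype.card A))

namespace Pair

variable {A : Type*} [Fintype A]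

theorem one_le (p : Pair A) (ε : Fin 2) (b : A) : 1 ≤ p.row ε b :=
  ((p.bijOn ε).mapsTo (Set.mem_univ b)).1

theorem le_card (p : Pair A) (ε : Fin 2) (b : A) : p.row ε b ≤ Fintype.card A :=
  ((p.bijOn ε).mapsTo (Set.mem_univ b)).2

theorem row_injective (p : Pair A) (ε : Fin 2) : Function.Injective (p.row ε) :=
  fun _ _ h => (p.bijOn ε).injOn (Set.mem_univ _) (Set.mem_univ _) h

theorem exists_last (p : Pair A) [Nonempty A] (ε : Fin 2) :
    ∃ z : A, p.row ε z = Fintype.card A := by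
  obtain ⟨z, _, hz⟩ := (p.bijOn ε).surjOn
    (show Fintype.card A ∈ Set.Icc 1 (Fintype.card A) from ⟨Fintype.card_pos, le_rfl⟩)
  exact ⟨z, hz⟩

/-- The last letter `p_ε⁻¹(#A)` of row `ε`. -/
noncomputable def last (p : Pair A) [Nonempty A] (ε : Fin 2) : A :=
  (p.exists_last ε).choose

theorem row_last (p : Pair A) [Nonempty A] (ε : Fin 2) :
    p.row ε (p.last ε) = Fintype.card A :=
  (p.exists_last ε).choose_spec

/-- The row `1 - ε` after a Rauzy move of type `ε`: with `z = p_ε⁻¹(#A)`, the last letter of the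
row `1 - ε` is moved to the place just after `z`. -/
noncomputable def movedRow (p : Pair A) (ε : Fin 2) (b : A) : ℕ :=
  haveI : Nonempty A := ⟨b⟩
  let z : A := p.last ε
  if p.row (1 - ε) b ≤ p.row (1 - ε) z then p.row (1 - ε) b
  else if p.row (1 - ε) b < Fintype.card A then p.row (1 - ε) b + 1
  else p.row (1 - ε) z + 1

theorem movedRow_bijOn (p : Pair A) (ε : Fin 2) :
    Set.BijOn (p.movedRow ε) Set.univ (Set.Icc 1 (Fintype.card A)) := by
  have hm : Set.MapsTo (p.movedRow ε) Set.univ (Set.Icc 1 (Fintype.card A)) := by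
    intro b _
    have : Nonempty A := ⟨b⟩
    have h1 := p.one_le (1 - ε) b
    have h2 := p.le_card (1 - ε) b
    simp only [movedRow, Set.mem_Icc]
    split_ifs <;> omega
  have hi : Set.InjOn (p.movedRow ε) Set.univ := by
    intro b _ c _ h
    have : Nonempty A := ⟨b⟩
    have h1 := p.le_card (1 - ε) b
    have h2 := p.le_card (1 - ε) c
    apply p.row_injective (1 - ε)
    simp only [movedRow] at h
    split_ifs at h <;> omega
  refine ⟨hm, hi, ?_⟩
  have := Finset.surjOn_of_injOn_of_card_le (s := (Finset.univ : Finset A))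
    (t := Finset.Icc 1 (Fintype.card A)) (p.movedRow ε) (by simpa using hm) (by simpa using hi)
    (by simp)
  simpa using this

/-- The Rauzy move of type `ε`. -/
noncomputable def rauzyMove (ε : Fin 2) (p : Pair A) : Pair A where
  row δ := if δ = ε then p.row ε else p.movedRow ε
  bijOn δ := by
    split_ifs
    · exact p.bijOn ε
    · exact p.movedRow_bijOn ε

/-- A pair is irreducible if, for `1 ≤ k ≤ #A`, the first `k` letters of the two rows agree as
sets exactly when `k = #A`. -/
def Irreducible (p : Pair A) : Prop :=
  ∀ k ∈ Set.Icc 1 (Fintype.card A),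
    (p.row 0 ⁻¹' Set.Icc 1 k = p.row 1 ⁻¹' Set.Icc 1 k ↔ k = Fintype.card A)

theorem Irreducible.rauzyMove {p : Pair A} (hp : p.Irreducible) (ε : Fin 2) :
    (rauzyMove ε p).Irreducible := by
  intro k hk
  constructor
  · intro h
    by_contra hne
    refine hne ((hp k hk).1 ?_)
    have hkn : k < Fintype.card A := lt_of_le_of_ne hk.2 hne
    have : Nonempty A := Fintype.card_pos_iff.1 (by omega)
    have e1 : (Pair.rauzyMove ε p).row ε = p.row ε := by simp [Pair.rauzyMove]
    have e2 : (Pair.rauzyMove ε p).row (1 - ε) = p.movedRow ε := by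
      have : (1 - ε : Fin 2) ≠ ε := by fin_cases ε <;> decide
      simp [Pair.rauzyMove, this]
    have h' : p.row ε ⁻¹' Set.Icc 1 k = p.movedRow ε ⁻¹' Set.Icc 1 k := by
      rw [← e1, ← e2]
      fin_cases ε
      · exact h
      · exact h.symm
    have hz : k < p.row (1 - ε) (p.last ε) := by
      by_contra hle
      have hmem : p.last ε ∈ p.movedRow ε ⁻¹' Set.Icc 1 k := by
        have := p.one_le (1 - ε) (p.last ε)
        simp only [Set.mem_preimage, Set.mem_Icc, movedRow]
        split_ifs <;> omega
      rw [← h'] at hmem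
      have := p.row_last ε
      simp only [Set.mem_preimage, Set.mem_Icc] at hmem
      omega
    have h2 : p.row ε ⁻¹' Set.Icc 1 k = p.row (1 - ε) ⁻¹' Set.Icc 1 k := by
      rw [h']
      ext b
      have := p.one_le (1 - ε) b
      simp only [Set.mem_preimage, Set.mem_Icc, movedRow]
      split_ifs <;> omega
    fin_cases ε
    · exact h2
    · exact h2.symm
  · rintro rfl
    ext b
    simp [one_le, le_card]

/-- A pair is standard if it is irreducible and the first letter of each row is the last letter
of the other row. -/
def IsStandard (p : Pair A) : Prop :=
  p.Irreducible ∧ (∀ b, p.row 0 b = 1 ↔ p.row 1 b = Fintype.card A) ∧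
    (∀ b, p.row 1 b = 1 ↔ p.row 0 b = Fintype.card A)

/-- Row `ε` of `p`, read from left to right, is the word `w`. -/
def Reads (p : Pair A) (ε : Fin 2) (w : List A) : Prop :=
  w.length = Fintype.card A ∧ ∀ (i : ℕ) (hi : i < w.length), p.row ε w[i] = i + 1

/-- `q` is the result of the `{b, c}`-inner switch on `p`: here `b` precedes `c` in both rows of
`p`, and neither of them is the first or the last letter of a row. -/
def InnerSwitch (b c : A) (p q : Pair A) : Prop :=
  ∃ (a z : A) (w₁ w₂ w₃ w₄ w₅ w₆ : List A),
    p.Reads 0 ([a] ++ w₁ ++ [b] ++ w₂ ++ [c] ++ w₃ ++ [z]) ∧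
    p.Reads 1 ([z] ++ w₄ ++ [b] ++ w₅ ++ [c] ++ w₆ ++ [a]) ∧
    q.Reads 0 ([a] ++ w₂ ++ [c] ++ w₁ ++ [b] ++ w₃ ++ [z]) ∧
    q.Reads 1 ([z] ++ w₅ ++ [c] ++ w₄ ++ [b] ++ w₆ ++ [a])

/-- `p` and `r` are connected by a finite sequence of inner switch moves. -/
def SwitchConnected (p r : Pair A) : Prop :=
  Relation.ReflTransGen (fun p q : Pair A => ∃ b c, InnerSwitch b c p q) p r

end Pair

/-- The irreducible pairs on `A`. -/
def IrrPair (A : Type*) [Fintype A] : Type _ := {p : Pair A // p.Irreducible}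

namespace IrrPair

variable {A : Type*} [Fintype A]

/-- The Rauzy move of type `ε` on irreducible pairs. -/
noncomputable def rauzyMove (ε : Fin 2) (p : IrrPair A) : IrrPair A :=
  ⟨Pair.rauzyMove ε p.1, p.2.rauzyMove ε⟩

/-- The labeled Rauzy class of `p`: the class of `p` under the smallest equivalence relation for
which every pair is equivalent to its images under the Rauzy moves of both types. -/
def rauzyClass (p : IrrPair A) : Set (IrrPair A) :=
  {q | Relation.EqvGen (fun s t : IrrPair A => ∃ ε, t = rauzyMove ε s) p q}

end IrrPair

/-! Write the rows of a pair as `U y S x` and `V x T y`. If a letter of `U` lies in `T`, or one of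
`V` in `S`, rotating the end of a row (a composite of Rauzy moves) brings that letter to the end of
the row and lowers `level`, the length of `U` plus that of `V`. This is `Red`. Irreducibility
supplies such a letter unless `U` and `V` are empty, so every pair reduces to a standard one, and
every Rauzy move is trivial, a reduction or the inverse of one. Reduction is confluent only up to
inner switches. Steps of the same type are comparable; steps of different types close up to a
`RelSwitch` of the old last letters (`Red.local_confluence`). After one reduction, a relative switch
becomes a product of two such switches at lower level (`RelSwitch.exists_red`). Induction on the
level then shows that all standard forms of a pair are switch connected (`switchEquiv_aux`), and
hence so are those of Rauzy equivalent pairs. Conversely, an inner switch is a product of four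
rotations (`RelSwitch.describes`). -/

namespace Pair

/-! ### Rows as words, and Rauzy moves on words. -/

variable {A : Type*} [Fintype A]

theorem reads_iff {p : Pair A} {ε : Fin 2} {w : List A} :
    p.Reads ε w ↔ w.length = Fintype.card A ∧
      ∀ u b v, w = u ++ b :: v → p.row ε b = u.length + 1 := by
  refine and_congr_right fun _ => ⟨?_, ?_⟩
  · rintro h u b v rfl
    simpa using h u.length (by simp)
  · intro h i hi
    have := h (w.take i) w[i] (w.drop (i + 1)) (by simp)
    simpa [Nat.min_eq_left hi.le] using this

theorem Reads.row_eq {p : Pair A} {ε : Fin 2} {u v : List A} {b : A}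
    (h : p.Reads ε (u ++ b :: v)) : p.row ε b = u.length + 1 :=
  (reads_iff.1 h).2 u b v rfl

theorem Reads.nodup {p : Pair A} {ε : Fin 2} {w : List A} (h : p.Reads ε w) : w.Nodup := by
  rw [List.nodup_iff_injective_get]
  intro i j hij
  have hi := h.2 i i.2
  have hj := h.2 j j.2
  simp only [List.get_eq_getElem] at hij
  rw [hij] at hi
  exact Fin.ext (by omega)

theorem Reads.mem {p : Pair A} {ε : Fin 2} {w : List A} (h : p.Reads ε w) (b : A) : b ∈ w := by
  have h1 := p.one_le ε b
  have h2 := p.le_card ε b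
  have hlt : p.row ε b - 1 < w.length := by rw [h.1]; omega
  have := h.2 _ hlt
  rw [p.row_injective ε (a₁ := b) (a₂ := w[p.row ε b - 1]) (by omega)]
  exact List.getElem_mem _

theorem exists_reads (p : Pair A) (ε : Fin 2) : ∃ w, p.Reads ε w := by
  have hs : ∀ i : Fin (Fintype.card A), ∃ b, p.row ε b = i + 1 := fun i => by
    obtain ⟨b, _, hb⟩ := (p.bijOn ε).surjOn
      (show (i : ℕ) + 1 ∈ Set.Icc 1 (Fintype.card A) from ⟨by omega, i.2⟩)
    exact ⟨b, hb⟩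
  choose f hf using hs
  exact ⟨List.ofFn f, by simp, fun i hi => by simp [hf]⟩

theorem Reads.eq {p : Pair A} {ε : Fin 2} {w w' : List A} (h : p.Reads ε w)
    (h' : p.Reads ε w') : w = w' :=
  List.ext_getElem (h.1.trans h'.1.symm) fun i hi hi' =>
    p.row_injective ε ((h.2 i hi).trans (h'.2 i hi').symm)

theorem eq_of_reads {p q : Pair A} {w₀ w₁ : List A} (hp₀ : p.Reads 0 w₀) (hp₁ : p.Reads 1 w₁)
    (hq₀ : q.Reads 0 w₀) (hq₁ : q.Reads 1 w₁) : p = q := by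
  have key : ∀ (ε : Fin 2) (w : List A), p.Reads ε w → q.Reads ε w → p.row ε = q.row ε := by
    intro ε w hp hq
    funext b
    obtain ⟨u, v, rfl⟩ := List.append_of_mem (hp.mem b)
    rw [hp.row_eq, hq.row_eq]
  ext ε : 2
  fin_cases ε
  · exact key _ _ hp₀ hq₀
  · exact key _ _ hp₁ hq₁

theorem rauzyMove_reads_same {p : Pair A} {ε : Fin 2} {w : List A} (h : p.Reads ε w) :
    (rauzyMove ε p).Reads ε w := by
  simpa [Reads, rauzyMove] using h

theorem rauzyMove_reads_other {p : Pair A} {ε : Fin 2} {u v w : List A} {x y : A}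
    (h : p.Reads ε (u ++ [x])) (h' : p.Reads (1 - ε) (v ++ x :: (w ++ [y]))) :
    (rauzyMove ε p).Reads (1 - ε) (v ++ x :: y :: w) := by
  have hne : (1 - ε : Fin 2) ≠ ε := by fin_cases ε <;> decide
  have hlen := h'.1
  simp only [List.length_append, List.length_cons, List.length_nil] at hlen
  have hx' := h'.row_eq
  have hy : p.row (1 - ε) y = Fintype.card A := by
    have : p.Reads (1 - ε) ((v ++ x :: w) ++ y :: []) := by simpa using h'
    rw [this.row_eq]
    simp only [List.length_append, List.length_cons]; omega
  have hlast : ∀ _ : Nonempty A, p.last ε = x := fun _ => by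
    apply p.row_injective ε
    rw [p.row_last, ← h.1, h.row_eq]
    simp
  have hrow : ∀ b, (rauzyMove ε p).row (1 - ε) b = p.movedRow ε b := fun b => by
    simp [rauzyMove, hne]
  rw [reads_iff]
  refine ⟨by simp only [List.length_append, List.length_cons]; omega, fun s b t hs => ?_⟩
  rw [hrow]
  simp only [movedRow, hlast, hx']
  rw [List.append_eq_append_iff] at hs
  rcases hs with ⟨s', rfl, hs⟩ | ⟨s', rfl, hs⟩
  · rcases s' with _ | ⟨x', s'⟩
    · simp only [List.nil_append, List.cons.injEq] at hs
      obtain ⟨rfl, rfl⟩ := hs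
      simp [hx']
    · simp only [List.cons_append, List.cons.injEq] at hs
      obtain ⟨rfl, hs⟩ := hs
      rcases s' with _ | ⟨y', s'⟩
      · simp only [List.nil_append, List.cons.injEq] at hs
        obtain ⟨rfl, rfl⟩ := hs
        simp only [hy, List.length_append, List.length_cons, List.length_nil]
        split_ifs <;> omega
      · simp only [List.cons_append, List.cons.injEq] at hs
        obtain ⟨rfl, rfl⟩ := hs
        have : p.Reads (1 - ε) ((v ++ x :: s') ++ b :: (t ++ [y])) := by simpa using h'
        have hb := this.row_eq
        simp only [List.length_append, List.length_cons] at hb hlen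
        simp only [hb, List.length_append, List.length_cons]
        split_ifs <;> omega
  · rcases s' with _ | ⟨b', s'⟩
    · simp only [List.nil_append, List.cons.injEq] at hs
      obtain ⟨rfl, rfl⟩ := hs
      simp [hx']
    · simp only [List.cons_append, List.cons.injEq] at hs
      obtain ⟨rfl, rfl⟩ := hs
      have : p.Reads (1 - ε) (s ++ b :: (s' ++ x :: (w ++ [y]))) := by simpa using h'
      have hb := this.row_eq
      simp [hb]

end Pair

/-! ### Rotations as composites of Rauzy moves, and irreducibility for words. -/

namespace IrrPair

variable {A : Type*} [Fintype A]

/-- Two irreducible pairs in the same labeled Rauzy class. -/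
def RauzyEquiv (p q : IrrPair A) : Prop :=
  Relation.EqvGen (fun s t : IrrPair A => ∃ ε, t = rauzyMove ε s) p q

theorem rauzyClass_eq_iff {p r : IrrPair A} : p.rauzyClass = r.rauzyClass ↔ p.RauzyEquiv r := by
  constructor
  · intro h
    have : r ∈ r.rauzyClass := .refl r
    rwa [← h] at this
  · intro h
    ext q
    exact ⟨fun hq => .trans _ _ _ (.symm _ _ h) hq, fun hq => .trans _ _ _ h hq⟩

/-- Each Rauzy move carries the last letter to the place after `x`, so `t.length` moves transfer `t`
as a block. Induction peels `t` from the right while `s` grows. -/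
theorem exists_rotate (ε : Fin 2) {u v : List A} {x : A} (t : List A) :
    ∀ (p : IrrPair A) (s : List A), p.1.Reads ε (u ++ [x]) →
      p.1.Reads (1 - ε) (v ++ x :: (s ++ t)) →
      ∃ q : IrrPair A, p.RauzyEquiv q ∧ q.1.Reads ε (u ++ [x]) ∧
        q.1.Reads (1 - ε) (v ++ x :: (t ++ s)) := by
  induction t using List.reverseRecOn with
  | nil => exact fun p s h h' => ⟨p, .refl p, h, by simpa using h'⟩
  | append_singleton t y ih =>
    intro p s h h'
    obtain ⟨q, hpq, hq, hq'⟩ := ih (rauzyMove ε p) (y :: s) (Pair.rauzyMove_reads_same h)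
      (Pair.rauzyMove_reads_other h (by simpa using h'))
    exact ⟨q, .trans _ _ _ (.rel _ _ ⟨ε, rfl⟩) hpq, hq, by simpa using hq'⟩

theorem exists_rotate_one {p : IrrPair A} {u v s t : List A} {x : A}
    (h : p.1.Reads 0 (u ++ [x])) (h' : p.1.Reads 1 (v ++ x :: (s ++ t))) :
    ∃ q : IrrPair A, p.RauzyEquiv q ∧ q.1.Reads 0 (u ++ [x]) ∧
      q.1.Reads 1 (v ++ x :: (t ++ s)) :=
  exists_rotate 0 t p s h h'

theorem exists_rotate_zero {p : IrrPair A} {u v s t : List A} {x : A}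
    (h : p.1.Reads 0 (v ++ x :: (s ++ t))) (h' : p.1.Reads 1 (u ++ [x])) :
    ∃ q : IrrPair A, p.RauzyEquiv q ∧ q.1.Reads 0 (v ++ x :: (t ++ s)) ∧
      q.1.Reads 1 (u ++ [x]) := by
  obtain ⟨q, h1, h2, h3⟩ := exists_rotate 1 t p s h' h
  exact ⟨q, h1, h3, h2⟩

/-- Irreducibility in terms of words. -/
theorem eq_nil_of_subset {p : IrrPair A} {u v u' v' : List A} {b : A}
    (h : p.1.Reads 0 (u ++ b :: u')) (h' : p.1.Reads 1 (v ++ v'))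
    (huv : u ⊆ v) (hvu : v ⊆ u) : u = [] ∧ v = [] := by
  have hperm : u.Perm v := (List.perm_ext_iff_of_nodup h.nodup.of_append_left
    h'.nodup.of_append_left).2 fun a => ⟨fun ha => huv ha, fun ha => hvu ha⟩
  have hl := hperm.length_eq
  have hu : u = [] := by
    by_contra hne
    have hpos : 0 < u.length := List.length_pos_iff.2 hne
    have hcard := h.1
    simp only [List.length_append, List.length_cons] at hcard
    have key : ∀ (ε : Fin 2) (s s' : List A), p.1.Reads ε (s ++ s') →
        p.1.row ε ⁻¹' Set.Icc 1 s.length = {a | a ∈ s} := by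
      intro ε s s' hs
      ext a
      simp only [Set.mem_preimage, Set.mem_Icc, Set.mem_ofPred_eq]
      constructor
      · rintro ⟨_, h2⟩
        rcases List.mem_append.1 (hs.mem a) with ha | ha
        · exact ha
        · obtain ⟨k, l, rfl⟩ := List.append_of_mem ha
          rw [← List.append_assoc] at hs
          have := hs.row_eq
          simp only [List.length_append] at this
          omega
      · intro ha
        refine ⟨p.1.one_le ε a, ?_⟩
        obtain ⟨k, l, rfl⟩ := List.append_of_mem ha
        rw [List.append_assoc] at hs
        have := hs.row_eq (u := k) (v := l ++ s')
        simp only [List.length_append, List.length_cons]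
        omega
    -- The letter `b` makes `u.length` smaller than the size of the alphabet, so this equality
    -- contradicts irreducibility.
    have := (p.2 u.length ⟨hpos, by omega⟩).1 (by
      rw [key 0 _ _ h, hl, key 1 _ _ h']
      ext a
      exact hperm.mem_iff)
    omega
  exact ⟨hu, by rw [← List.length_eq_zero_iff, ← hl, hu]; rfl⟩

end IrrPair

/-! ### Row data, reductions and relative switches. -/

/-- The data of a pair with at least two letters: its rows are the words `U y S x` and
`V x T y`. -/
structure RowData (A : Type*) where
  U : List A
  y : A
  S : List A
  V : List A
  x : A
  T : List A

namespace RowData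

variable {A : Type*}

/-- The row `0`. -/
def row₀ (q : RowData A) : List A := q.U ++ q.y :: (q.S ++ [q.x])

/-- The row `1`. -/
def row₁ (q : RowData A) : List A := q.V ++ q.x :: (q.T ++ [q.y])

/-- The number of letters in front of the last letters of the opposite rows. -/
def level (q : RowData A) : ℕ := q.U.length + q.V.length

/-- The rows are `y S x` and `x T y`. -/
def Standard (q : RowData A) : Prop := q.U = [] ∧ q.V = []

/-- A sequence of Rauzy moves of one type that moves the last letter of the moving row to the
left in the other row. -/
inductive Red : RowData A → RowData A → Prop
  | one (U₁ U₂ S V T₁ T₂ : List A) (x y t : A) :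
    Red ⟨U₁ ++ t :: U₂, y, S, V, x, T₁ ++ t :: T₂⟩ ⟨U₁, t, U₂ ++ y :: S, V, x, T₂ ++ y :: T₁⟩
  | zero (U S₁ S₂ V₁ V₂ T : List A) (x y s : A) :
    Red ⟨U, y, S₁ ++ s :: S₂, V₁ ++ s :: V₂, x, T⟩ ⟨U, y, S₂ ++ x :: S₁, V₁, s, V₂ ++ x :: T⟩

/-- The inner switch relative to arbitrary prefixes `U y` and `V x` of the rows. -/
inductive RelSwitch : RowData A → RowData A → Prop
  | intro (U V w₁ w₂ w₃ w₄ w₅ w₆ : List A) (x y b c : A) :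
    RelSwitch ⟨U, y, w₁ ++ b :: (w₂ ++ c :: w₃), V, x, w₄ ++ b :: (w₅ ++ c :: w₆)⟩
      ⟨U, y, w₂ ++ c :: (w₁ ++ b :: w₃), V, x, w₅ ++ c :: (w₄ ++ b :: w₆)⟩

/-- Connected by inner switches of standard pairs. -/
def SwitchEquiv : RowData A → RowData A → Prop :=
  Relation.ReflTransGen fun q q' => q.Standard ∧ RelSwitch q q'

/-- The standard `s` is obtained from `q` by steps `Red`. -/
def Leads (q s : RowData A) : Prop := s.Standard ∧ Relation.ReflTransGen Red q s

theorem Red.level_lt {q q' : RowData A} (h : Red q q') : q'.level < q.level := by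
  cases h <;> simp [level]

theorem RelSwitch.symm {q q' : RowData A} (h : RelSwitch q q') : RelSwitch q' q := by
  cases h
  apply RelSwitch.intro

theorem RelSwitch.level_eq {q q' : RowData A} (h : RelSwitch q q') : q'.level = q.level := by
  cases h
  rfl

theorem RelSwitch.standard {q q' : RowData A} (h : RelSwitch q q') (hq : q.Standard) :
    q'.Standard := by
  cases h
  exact hq

theorem SwitchEquiv.symm {q q' : RowData A} (h : SwitchEquiv q q') : SwitchEquiv q' q := by
  induction h with
  | refl => exact .refl
  | tail _ h ih => exact .head ⟨h.2.standard h.1, h.2.symm⟩ ih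

theorem SwitchEquiv.trans {q q' q'' : RowData A} (h : SwitchEquiv q q')
    (h' : SwitchEquiv q' q'') : SwitchEquiv q q'' :=
  Relation.ReflTransGen.trans h h'

theorem Standard.not_red {q q' : RowData A} (hq : q.Standard) : ¬ Red q q' := by
  intro h
  cases h <;> simp [Standard] at hq

theorem Standard.leads {q : RowData A} (hq : q.Standard) : Leads q q := ⟨hq, .refl⟩

theorem Standard.eq_of_leads {q s : RowData A} (hq : q.Standard) (h : Leads q s) : q = s := by
  rcases h.2.cases_head with h | ⟨_, h, _⟩
  · exact h
  · exact absurd h hq.not_red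

theorem Leads.head {q q' s : RowData A} (h : Red q q') (h' : Leads q' s) : Leads q s :=
  ⟨h'.1, .head h h'.2⟩

/-! ### Local confluence up to relative switches. -/

/-- Two decompositions of a word at one of its letters. -/
theorem append_cons_cases {l₁ l₂ l₁' l₂' : List A} {a a' : A}
    (h : l₁ ++ a :: l₂ = l₁' ++ a' :: l₂') :
    (l₁ = l₁' ∧ a = a' ∧ l₂ = l₂') ∨ (∃ m, l₁' = l₁ ++ a :: m ∧ l₂ = m ++ a' :: l₂') ∨
      ∃ m, l₁ = l₁' ++ a' :: m ∧ l₂' = m ++ a :: l₂ := by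
  rw [List.append_eq_append_iff] at h
  rcases h with ⟨m, rfl, h⟩ | ⟨m, rfl, h⟩ <;> rcases m with _ | ⟨b, m⟩ <;>
    simp_all

theorem append_cons_inj {l₁ l₂ l₁' l₂' : List A} {a : A}
    (h : l₁ ++ a :: l₂ = l₁' ++ a :: l₂') (hn : (l₁ ++ a :: l₂).Nodup) :
    l₁ = l₁' ∧ l₂ = l₂' := by
  rcases append_cons_cases h with ⟨h₁, _, h₂⟩ | ⟨m, rfl, rfl⟩ | ⟨m, rfl, rfl⟩
  · exact ⟨h₁, h₂⟩
  · simp [List.nodup_append] at hn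
  · simp [List.nodup_append] at hn

/-- Exchange of the two rows. -/
def flip (q : RowData A) : RowData A := ⟨q.V, q.x, q.T, q.U, q.y, q.S⟩

theorem Red.flip {q q' : RowData A} (h : Red q q') : Red q.flip q'.flip := by
  cases h <;> constructor

/-- This inversion keeps the decompositions as equations, so that two steps from the same data can
be compared. -/
theorem red_iff {U S V T : List A} {x y : A} {q : RowData A} :
    Red ⟨U, y, S, V, x, T⟩ q ↔
      (∃ t U₁ U₂ T₁ T₂, U = U₁ ++ t :: U₂ ∧ T = T₁ ++ t :: T₂ ∧
        q = ⟨U₁, t, U₂ ++ y :: S, V, x, T₂ ++ y :: T₁⟩) ∨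
      ∃ s S₁ S₂ V₁ V₂, S = S₁ ++ s :: S₂ ∧ V = V₁ ++ s :: V₂ ∧
        q = ⟨U, y, S₂ ++ x :: S₁, V₁, s, V₂ ++ x :: T⟩ := by
  constructor
  · intro h
    cases h
    · exact .inl ⟨_, _, _, _, _, rfl, rfl, rfl⟩
    · exact .inr ⟨_, _, _, _, _, rfl, rfl, rfl⟩
  · rintro (⟨t, U₁, U₂, T₁, T₂, rfl, rfl, rfl⟩ | ⟨s, S₁, S₂, V₁, V₂, rfl, rfl, rfl⟩)
    · constructor
    · constructor

/-- Rotations compose: bringing `t'` to the end and then `t` has the same effect as bringing `t`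
there at once. -/
theorem red_of_lt {U₁ m U₂ T₁ T₂ T₁' T₂' S V : List A} {x y t t' : A} (ht : t ≠ t')
    (hT : T₁ ++ t :: T₂ = T₁' ++ t' :: T₂') :
    Red ⟨U₁ ++ t :: m, t', U₂ ++ y :: S, V, x, T₂' ++ y :: T₁'⟩
      ⟨U₁, t, (m ++ t' :: U₂) ++ y :: S, V, x, T₂ ++ y :: T₁⟩ := by
  rcases append_cons_cases hT with ⟨_, h, _⟩ | ⟨k, rfl, rfl⟩ | ⟨k, rfl, rfl⟩
  · exact absurd h ht
  · have := Red.one U₁ m (U₂ ++ y :: S) V (T₂' ++ y :: T₁) k x t' t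
    simpa using this
  · have := Red.one U₁ m (U₂ ++ y :: S) V k (T₂ ++ y :: T₁') x t' t
    simpa using this

/-- Two steps `Red` of the same type agree or differ by a step `Red`. -/
theorem red_comparable {U₁ U₂ U₁' U₂' T₁ T₂ T₁' T₂' S V : List A} {x y t t' : A}
    (hU : U₁ ++ t :: U₂ = U₁' ++ t' :: U₂') (hT : T₁ ++ t :: T₂ = T₁' ++ t' :: T₂')
    (hn : (U₁ ++ t :: U₂).Nodup) (hn' : (T₁ ++ t :: T₂).Nodup) :
    let q : RowData A := ⟨U₁, t, U₂ ++ y :: S, V, x, T₂ ++ y :: T₁⟩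
    let q' : RowData A := ⟨U₁', t', U₂' ++ y :: S, V, x, T₂' ++ y :: T₁'⟩
    q = q' ∨ Red q q' ∨ Red q' q := by
  intro q q'
  rcases append_cons_cases hU with ⟨rfl, rfl, rfl⟩ | ⟨k, rfl, rfl⟩ | ⟨k, rfl, rfl⟩
  · obtain ⟨rfl, rfl⟩ := append_cons_inj hT hn'
    exact .inl rfl
  · exact .inr (.inr (red_of_lt (by rintro rfl; simp [List.nodup_append] at hn) hT))
  · exact .inr (.inl (red_of_lt (by rintro rfl; simp [List.nodup_append] at hn) hT.symm))

/-- Each of the two steps remains available after the other. The two orders leave the old last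
letters `x` and `y` inside both rows, in opposite orders, and differ by the switch of `x` and `y`.
-/
theorem red_diamond (U₁ U₂ S₁ S₂ V₁ V₂ T₁ T₂ : List A) (x y s t : A) :
    ∃ q q', Red ⟨U₁, t, U₂ ++ y :: (S₁ ++ s :: S₂), V₁ ++ s :: V₂, x, T₂ ++ y :: T₁⟩ q ∧
      Red ⟨U₁ ++ t :: U₂, y, S₂ ++ x :: S₁, V₁, s, V₂ ++ x :: (T₁ ++ t :: T₂)⟩ q' ∧
      RelSwitch q q' := by
  refine ⟨⟨U₁, t, S₂ ++ x :: (U₂ ++ y :: S₁), V₁, s, V₂ ++ x :: (T₂ ++ y :: T₁)⟩,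
    ⟨U₁, t, U₂ ++ y :: (S₂ ++ x :: S₁), V₁, s, T₂ ++ y :: (V₂ ++ x :: T₁)⟩, ?_, ?_, ?_⟩
  · have := Red.zero U₁ (U₂ ++ y :: S₁) S₂ V₁ V₂ (T₂ ++ y :: T₁) x t s
    simpa using this
  · have := Red.one U₁ U₂ (S₂ ++ x :: S₁) V₁ (V₂ ++ x :: T₁) T₂ s y t
    simpa using this
  · constructor

theorem Red.local_confluence {q q₁ q₂ : RowData A} (h₀ : q.row₀.Nodup) (h₁ : q.row₁.Nodup)
    (h : Red q q₁) (h' : Red q q₂) :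
    q₁ = q₂ ∨ Red q₁ q₂ ∨ Red q₂ q₁ ∨ ∃ r₁ r₂, Red q₁ r₁ ∧ Red q₂ r₂ ∧ RelSwitch r₁ r₂ := by
  obtain ⟨U, y, S, V, x, T⟩ := q
  have nU : U.Nodup := h₀.of_append_left
  have nV : V.Nodup := h₁.of_append_left
  have nS : S.Nodup := (List.nodup_cons.1 h₀.of_append_right).2.of_append_left
  have nT : T.Nodup := (List.nodup_cons.1 h₁.of_append_right).2.of_append_left
  clear h₀ h₁
  rcases red_iff.1 h with ⟨t, U₁, U₂, T₁, T₂, rfl, rfl, rfl⟩ | ⟨s, S₁, S₂, V₁, V₂, rfl, rfl, rfl⟩ <;>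
    rcases red_iff.1 h' with
      ⟨t', U₁', U₂', T₁', T₂', hU, hT, rfl⟩ | ⟨s', S₁', S₂', V₁', V₂', hS, hV, rfl⟩
  · have := red_comparable (S := S) (V := V) (x := x) (y := y) hU hT nU nT
    tauto
  · subst hS hV
    obtain ⟨r₁, r₂, h⟩ := red_diamond U₁ U₂ S₁' S₂' V₁' V₂' T₁ T₂ x y s' t
    exact .inr (.inr (.inr ⟨r₁, r₂, h⟩))
  · subst hU hT
    obtain ⟨r₁, r₂, h⟩ := red_diamond U₁' U₂' S₁ S₂ V₁ V₂ T₁' T₂' x y s t'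
    exact .inr (.inr (.inr ⟨r₂, r₁, h.2.1, h.1, h.2.2.symm⟩))
  · have := red_comparable (S := T) (V := U) (x := y) (y := x) hV hS nV nS
    rcases this with h | h | h
    · simp only [RowData.mk.injEq] at h ⊢
      tauto
    · exact .inr (.inl h.flip)
    · exact .inr (.inr (.inl h.flip))

/-! ### Reducing a relative switch, and Rauzy moves as reductions. -/

/-- A relative inner switch with prefixes `U y` and `V x` is a product of two relative inner
switches with shorter prefixes. -/
theorem RelSwitch.exists_red_of_mem {q q' : RowData A} (h : RelSwitch q q') {t : A}
    (htU : t ∈ q.U) (htT : t ∈ q.T) (hn : q.row₀.Nodup) (hn' : q.row₁.Nodup) :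
    ∃ r m r', Red q r ∧ RelSwitch r m ∧ RelSwitch m r' ∧ Red q' r' := by
  cases h with
  | intro U V w₁ w₂ w₃ w₄ w₅ w₆ x y b c =>
  obtain ⟨U₁, U₂, rfl⟩ := List.append_of_mem htU
  simp only [List.mem_append, List.mem_cons] at htT
  have hb : t ≠ b := by
    rintro rfl
    simp [row₀, List.nodup_append] at hn
  have hc : t ≠ c := by
    rintro rfl
    simp [row₀, List.nodup_append] at hn
  -- The letter `t` lies in `w₄`, `w₅` or `w₆`. After the reduction `y` is an inner letter, and the
  -- two switches are `{b, c}` then `{c, y}`, except for `t` in `w₅`, where they are `{y, b}` then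
  -- `{b, c}`.
  rcases htT with h | h | h | h | h
  · obtain ⟨k, l, rfl⟩ := List.append_of_mem h
    have e₁ := Red.one U₁ U₂ (w₁ ++ b :: (w₂ ++ c :: w₃)) V k (l ++ b :: (w₅ ++ c :: w₆)) x y t
    have e₂ := RelSwitch.intro U₁ V (U₂ ++ y :: w₁) w₂ w₃ l w₅ (w₆ ++ y :: k) x t b c
    have e₃ := RelSwitch.intro U₁ V w₂ U₂ (w₁ ++ b :: w₃) w₅ (l ++ b :: w₆) k x t c y
    have e₄ := Red.one U₁ U₂ (w₂ ++ c :: (w₁ ++ b :: w₃)) V (w₅ ++ c :: k) (l ++ b :: w₆) x y t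
    simp only [List.append_assoc, List.cons_append] at e₁ e₂ e₃ e₄ ⊢
    exact ⟨_, _, _, e₁, e₂, e₃, e₄⟩
  · exact absurd h hb
  · obtain ⟨k, l, rfl⟩ := List.append_of_mem h
    have e₁ := Red.one U₁ U₂ (w₁ ++ b :: (w₂ ++ c :: w₃)) V (w₄ ++ b :: k) (l ++ c :: w₆) x y t
    have e₂ := RelSwitch.intro U₁ V U₂ w₁ (w₂ ++ c :: w₃) (l ++ c :: w₆) w₄ k x t y b
    have e₃ := RelSwitch.intro U₁ V w₁ (U₂ ++ y :: w₂) w₃ w₄ l (w₆ ++ y :: k) x t b c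
    have e₄ := Red.one U₁ U₂ (w₂ ++ c :: (w₁ ++ b :: w₃)) V k (l ++ c :: (w₄ ++ b :: w₆)) x y t
    simp only [List.append_assoc, List.cons_append] at e₁ e₂ e₃ e₄ ⊢
    exact ⟨_, _, _, e₁, e₂, e₃, e₄⟩
  · exact absurd h hc
  · obtain ⟨k, l, rfl⟩ := List.append_of_mem h
    have e₁ := Red.one U₁ U₂ (w₁ ++ b :: (w₂ ++ c :: w₃)) V (w₄ ++ b :: (w₅ ++ c :: k)) l x y t
    have e₂ := RelSwitch.intro U₁ V (U₂ ++ y :: w₁) w₂ w₃ (l ++ y :: w₄) w₅ k x t b c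
    have e₃ := RelSwitch.intro U₁ V w₂ U₂ (w₁ ++ b :: w₃) w₅ l (w₄ ++ b :: k) x t c y
    have e₄ := Red.one U₁ U₂ (w₂ ++ c :: (w₁ ++ b :: w₃)) V (w₅ ++ c :: (w₄ ++ b :: k)) l x y t
    simp only [List.append_assoc, List.cons_append] at e₁ e₂ e₃ e₄ ⊢
    exact ⟨_, _, _, e₁, e₂, e₃, e₄⟩

theorem RelSwitch.flip {q q' : RowData A} (h : RelSwitch q q') : RelSwitch q.flip q'.flip := by
  cases h
  constructor

theorem exists_red_of_move (q : RowData A) (hn : q.row₁.Nodup) (hm : ∀ a, a ∈ q.row₀) :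
    ∃ q' : RowData A, q'.row₀ = q.row₀ ∧ q'.row₁ = q.V ++ q.x :: q.y :: q.T ∧
      (q = q' ∨ Red q q' ∨ Red q' q) := by
  obtain ⟨U, y, S, V, x, T⟩ := q
  rcases T.eq_nil_or_concat' with rfl | ⟨T, t, rfl⟩
  · exact ⟨_, rfl, rfl, .inl rfl⟩
  have ht := hm t
  simp only [row₀, List.mem_append, List.mem_cons, List.not_mem_nil, or_false] at ht
  -- The move makes `t` the new last letter of row 1: a reduction if `t` lies before `y` in row 0,
  -- the inverse of one if it lies after.
  rcases ht with h | h | h | h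
  · obtain ⟨U₁, U₂, rfl⟩ := List.append_of_mem h
    exact ⟨⟨U₁, t, U₂ ++ y :: S, V, x, y :: T⟩, by simp [row₀], by simp [row₁],
      .inr (.inl (Red.one U₁ U₂ S V T [] x y t))⟩
  · subst h
    simp [row₁, List.nodup_append] at hn
  · obtain ⟨S₁, S₂, rfl⟩ := List.append_of_mem h
    exact ⟨⟨U ++ y :: S₁, t, S₂, V, x, y :: T⟩, by simp [row₀], by simp [row₁],
      .inr (.inr (Red.one U S₁ S₂ V [] T x t y))⟩
  · subst h
    simp [row₁, List.nodup_append] at hn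

/-! ### Reductions and switches realised by Rauzy moves. -/

variable [Fintype A]

/-- `q` describes the rows of the irreducible pair `p`. -/
def Describes (q : RowData A) (p : IrrPair A) : Prop :=
  p.1.Reads 0 q.row₀ ∧ p.1.Reads 1 q.row₁

/-- `q` describes an irreducible pair. -/
def Valid (q : RowData A) : Prop := ∃ p, q.Describes p

theorem Describes.of_row_eq {q : RowData A} {p : IrrPair A} {w₀ w₁ : List A}
    (h₀ : p.1.Reads 0 w₀) (h₁ : p.1.Reads 1 w₁) (e₀ : w₀ = q.row₀) (e₁ : w₁ = q.row₁) :
    q.Describes p := by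
  subst e₀ e₁
  exact ⟨h₀, h₁⟩

theorem Red.describes {q q' : RowData A} {p : IrrPair A} (h : Red q q') (hq : q.Describes p) :
    ∃ p', p.RauzyEquiv p' ∧ q'.Describes p' := by
  cases h with
  | one U₁ U₂ S V T₁ T₂ x y t =>
    obtain ⟨p', hp, h₀, h₁⟩ := IrrPair.exists_rotate_one (p := p) (x := x)
      (u := U₁ ++ t :: (U₂ ++ y :: S)) (v := V) (s := T₁ ++ [t]) (t := T₂ ++ [y])
      (by simpa [row₀] using hq.1) (by simpa [row₁] using hq.2)
    exact ⟨p', hp, .of_row_eq h₀ h₁ (by simp [row₀]) (by simp [row₁])⟩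
  | zero U S₁ S₂ V₁ V₂ T x y s =>
    obtain ⟨p', hp, h₀, h₁⟩ := IrrPair.exists_rotate_zero (p := p) (x := y)
      (u := V₁ ++ s :: (V₂ ++ x :: T)) (v := U) (s := S₁ ++ [s]) (t := S₂ ++ [x])
      (by simpa [row₀] using hq.1) (by simpa [row₁] using hq.2)
    exact ⟨p', hp, .of_row_eq h₀ h₁ (by simp [row₀]) (by simp [row₁])⟩

/-- Four rotations, alternating between the rows, after `x`, `b`, `c` and `y`. Each one exposes the
last letter after which the next one rotates, and the final one restores the ends `x` and `y`. -/
theorem RelSwitch.describes {q q' : RowData A} {p : IrrPair A} (h : RelSwitch q q')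
    (hq : q.Describes p) : ∃ p', p.RauzyEquiv p' ∧ q'.Describes p' := by
  cases h with
  | intro U V w₁ w₂ w₃ w₄ w₅ w₆ x y b c =>
    obtain ⟨p₁, hp₁, h₀, h₁⟩ := IrrPair.exists_rotate_one (p := p) (x := x)
      (u := U ++ y :: (w₁ ++ b :: (w₂ ++ c :: w₃))) (v := V) (s := w₄ ++ [b])
      (t := w₅ ++ c :: (w₆ ++ [y])) (by simpa [row₀] using hq.1) (by simpa [row₁] using hq.2)
    obtain ⟨p₂, hp₂, h₀, h₁⟩ := IrrPair.exists_rotate_zero (p := p₁) (x := b)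
      (u := V ++ x :: (w₅ ++ c :: (w₆ ++ y :: w₄))) (v := U ++ y :: w₁) (s := w₂ ++ [c])
      (t := w₃ ++ [x]) (by simpa using h₀) (by simpa using h₁)
    obtain ⟨p₃, hp₃, h₀, h₁⟩ := IrrPair.exists_rotate_one (p := p₂) (x := c)
      (u := U ++ y :: (w₁ ++ b :: (w₃ ++ x :: w₂))) (v := V ++ x :: w₅) (s := w₆ ++ [y])
      (t := w₄ ++ [b]) (by simpa using h₀) (by simpa using h₁)
    obtain ⟨p₄, hp₄, h₀, h₁⟩ := IrrPair.exists_rotate_zero (p := p₃) (x := y)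
      (u := V ++ x :: (w₅ ++ c :: (w₄ ++ b :: w₆))) (v := U) (s := w₁ ++ b :: (w₃ ++ [x]))
      (t := w₂ ++ [c]) (by simpa using h₀) (by simpa using h₁)
    exact ⟨p₄, .trans _ _ _ hp₁ (.trans _ _ _ hp₂ (.trans _ _ _ hp₃ hp₄)),
      .of_row_eq h₀ h₁ (by simp [row₀]) (by simp [row₁])⟩

theorem Red.valid {q q' : RowData A} (h : Red q q') : q.Valid → q'.Valid :=
  fun ⟨_, hq⟩ => let ⟨p', _, hp'⟩ := h.describes hq; ⟨p', hp'⟩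

theorem RelSwitch.valid {q q' : RowData A} (h : RelSwitch q q') : q.Valid → q'.Valid :=
  fun ⟨_, hq⟩ => let ⟨p', _, hp'⟩ := h.describes hq; ⟨p', hp'⟩

theorem Valid.nodup₀ {q : RowData A} : q.Valid → q.row₀.Nodup := fun ⟨_, h⟩ => h.1.nodup

theorem Valid.nodup₁ {q : RowData A} : q.Valid → q.row₁.Nodup := fun ⟨_, h⟩ => h.2.nodup

/-! ### Termination and global confluence. -/

theorem Valid.exists_mem {q : RowData A} (hq : q.Valid) (hs : ¬ q.Standard) :
    (∃ t ∈ q.U, t ∈ q.T) ∨ ∃ s ∈ q.V, s ∈ q.S := by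
  by_contra! hne
  obtain ⟨hU, hV⟩ := hne
  have n₀ := hq.nodup₀
  have n₁ := hq.nodup₁
  obtain ⟨p, h₀, h₁⟩ := hq
  -- A letter of `U` is neither `x` nor `y`, so if it is not in `T` it must be in `V`; symmetrically
  -- for `V`.
  refine hs (IrrPair.eq_nil_of_subset h₀ h₁ ?_ ?_)
  · intro a ha
    have := h₁.mem a
    simp only [row₀, row₁] at *
    grind
  · intro a ha
    have := h₀.mem a
    simp only [row₀, row₁] at *
    grind

theorem Valid.exists_red {q : RowData A} (hq : q.Valid) (hs : ¬ q.Standard) :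
    ∃ q', Red q q' := by
  obtain ⟨U, y, S, V, x, T⟩ := q
  rcases hq.exists_mem hs with ⟨t, h, h'⟩ | ⟨t, h, h'⟩ <;>
  · obtain ⟨_, _, rfl⟩ := List.append_of_mem h
    obtain ⟨_, _, rfl⟩ := List.append_of_mem h'
    exact ⟨_, by constructor⟩

theorem Valid.exists_leads {q : RowData A} (hq : q.Valid) : ∃ s, Leads q s := by
  induction hn : q.level using Nat.strong_induction_on generalizing q with
  | _ n ih =>
    by_cases hs : q.Standard
    · exact ⟨q, hs.leads⟩
    · obtain ⟨q', h⟩ := hq.exists_red hs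
      obtain ⟨s, hs⟩ := ih _ (hn ▸ h.level_lt) (h.valid hq) rfl
      exact ⟨s, hs.head h⟩

theorem RelSwitch.exists_red {q q' : RowData A} (h : RelSwitch q q') (hq : q.Valid)
    (hs : ¬ q.Standard) : ∃ r m r', Red q r ∧ RelSwitch r m ∧ RelSwitch m r' ∧ Red q' r' := by
  rcases hq.exists_mem hs with ⟨t, htU, htT⟩ | ⟨t, htV, htS⟩
  · exact h.exists_red_of_mem htU htT hq.nodup₀ hq.nodup₁
  · obtain ⟨r, m, r', h₁, h₂, h₃, h₄⟩ :=
      h.flip.exists_red_of_mem htV htS hq.nodup₁ hq.nodup₀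
    exact ⟨r.flip, m.flip, r'.flip, h₁.flip, h₂.flip, h₃.flip, h₄.flip⟩

/-- The two claims need a joint induction: the diamond in the first needs the second at lower level,
and the second at level `n` needs the first at the same level, for both `q` and `q'`. -/
theorem switchEquiv_aux (n : ℕ) :
    (∀ q s s' : RowData A, q.level = n → q.Valid → Leads q s → Leads q s' → SwitchEquiv s s') ∧
      ∀ q q' s s' : RowData A, q.level = n → q.Valid → RelSwitch q q' → Leads q s →
        Leads q' s' → SwitchEquiv s s' := by
  induction n using Nat.strong_induction_on with
  | _ n ih =>
  have hA : ∀ q s s' : RowData A, q.level = n → q.Valid → Leads q s → Leads q s' →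
      SwitchEquiv s s' := by
    rintro q s s' rfl hq ⟨hs, h⟩ ⟨hs', h'⟩
    rcases h.cases_head with rfl | ⟨q₁, h₁, h⟩
    · rw [hs.eq_of_leads ⟨hs', h'⟩]
      exact .refl
    rcases h'.cases_head with rfl | ⟨q₂, h₂, h'⟩
    · exact absurd h₁ hs'.not_red
    have v₁ := h₁.valid hq
    have v₂ := h₂.valid hq
    rcases h₁.local_confluence hq.nodup₀ hq.nodup₁ h₂ with
      rfl | e | e | ⟨r₁, r₂, e₁, e₂, e⟩
    · exact (ih _ h₁.level_lt).1 q₁ s s' rfl v₁ ⟨hs, h⟩ ⟨hs', h'⟩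
    · exact (ih _ h₁.level_lt).1 q₁ s s' rfl v₁ ⟨hs, h⟩ ⟨hs', .head e h'⟩
    · exact (ih _ h₂.level_lt).1 q₂ s s' rfl v₂ ⟨hs, .head e h⟩ ⟨hs', h'⟩
    · obtain ⟨s₁, l₁⟩ := (e₁.valid v₁).exists_leads
      obtain ⟨s₂, l₂⟩ := (e₂.valid v₂).exists_leads
      have i₁ := (ih _ h₁.level_lt).1 q₁ s s₁ rfl v₁ ⟨hs, h⟩ (l₁.head e₁)
      have i₂ := (ih _ h₂.level_lt).1 q₂ s₂ s' rfl v₂ (l₂.head e₂) ⟨hs', h'⟩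
      have i := (ih _ (e₁.level_lt.trans h₁.level_lt)).2 r₁ r₂ s₁ s₂ rfl (e₁.valid v₁) e l₁ l₂
      exact i₁.trans (i.trans i₂)
  refine ⟨hA, ?_⟩
  rintro q q' s s' rfl hq hqq l l'
  by_cases hs : q.Standard
  · obtain rfl := hs.eq_of_leads l
    obtain rfl := (hqq.standard hs).eq_of_leads l'
    exact .single ⟨hs, hqq⟩
  obtain ⟨r, m, r', e₁, e₂, e₃, e₄⟩ := hqq.exists_red hq hs
  have vr := e₁.valid hq
  have vm := e₂.valid vr
  have vq' := hqq.valid hq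
  obtain ⟨s₁, l₁⟩ := vr.exists_leads
  obtain ⟨s₂, l₂⟩ := vm.exists_leads
  obtain ⟨s₃, l₃⟩ := (e₄.valid vq').exists_leads
  have i₁ := hA q s s₁ rfl hq l (l₁.head e₁)
  have i₂ := (ih _ e₁.level_lt).2 r m s₁ s₂ rfl vr e₂ l₁ l₂
  have i₃ := (ih _ (e₂.level_eq ▸ e₁.level_lt)).2 m r' s₂ s₃ rfl vm e₃ l₂ l₃
  have i₄ := hA q' s₃ s' hqq.level_eq vq' (l₃.head e₄) l'
  exact i₁.trans (i₂.trans (i₃.trans i₄))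

/-- The standard pairs obtained from an irreducible pair by steps `Red` are connected by inner
switches. -/
theorem Leads.switchEquiv {q s s' : RowData A} (h : Leads q s) (h' : Leads q s')
    (hq : q.Valid) : SwitchEquiv s s' :=
  (switchEquiv_aux q.level).1 q s s' rfl hq h h'

/-! ### Translation between irreducible pairs and row data. -/

theorem Describes.eq {q q' : RowData A} {p : IrrPair A} (h : q.Describes p)
    (h' : q'.Describes p) : q = q' := by
  obtain ⟨U, y, S, V, x, T⟩ := q
  obtain ⟨U', y', S', V', x', T'⟩ := q'
  have e₀ : U ++ y :: (S ++ [x]) = U' ++ y' :: (S' ++ [x']) := h.1.eq h'.1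
  have e₁ : V ++ x :: (T ++ [y]) = V' ++ x' :: (T' ++ [y']) := h.2.eq h'.2
  have ex : (U ++ y :: S) ++ [x] = (U' ++ y' :: S') ++ [x'] := by simpa using e₀
  have ey : (V ++ x :: T) ++ [y] = (V' ++ x' :: T') ++ [y'] := by simpa using e₁
  replace ex : x = x' := by simpa using (List.append_inj' ex rfl).2
  replace ey : y = y' := by simpa using (List.append_inj' ey rfl).2
  subst ex ey
  obtain ⟨rfl, f₀⟩ := append_cons_inj e₀ h.1.nodup
  obtain ⟨rfl, f₁⟩ := append_cons_inj e₁ h.2.nodup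
  simp_all

theorem exists_describes (p : IrrPair A) (hA : 2 ≤ Fintype.card A) :
    ∃ q : RowData A, q.Describes p := by
  obtain ⟨w₀, h₀⟩ := p.1.exists_reads 0
  obtain ⟨w₁, h₁⟩ := p.1.exists_reads 1
  have l₀ := h₀.1
  have l₁ := h₁.1
  rcases w₀.eq_nil_or_concat' with rfl | ⟨w₀, x, rfl⟩
  · simp at l₀; omega
  rcases w₁.eq_nil_or_concat' with rfl | ⟨w₁, y, rfl⟩
  · simp at l₁; omega
  -- With equal last letters, the remaining prefixes would have the same letters, hence be empty by
  -- irreducibility.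
  have hxy : x ≠ y := by
    rintro rfl
    have n₀ := h₀.nodup
    have n₁ := h₁.nodup
    obtain ⟨rfl, -⟩ := IrrPair.eq_nil_of_subset (u := w₀) (v := w₁) h₀ h₁
      (fun a ha => by
        have := h₁.mem a
        grind)
      (fun a ha => by
        have := h₀.mem a
        grind)
    simp at l₀; omega
  have hy : y ∈ w₀ := by
    have := h₀.mem y
    grind
  have hx : x ∈ w₁ := by
    have := h₁.mem x
    grind
  obtain ⟨U, S, rfl⟩ := List.append_of_mem hy
  obtain ⟨V, T, rfl⟩ := List.append_of_mem hx
  exact ⟨⟨U, y, S, V, x, T⟩, .of_row_eq h₀ h₁ (by simp [row₀]) (by simp [row₁])⟩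

/-- A Rauzy move is trivial, a step `Red` or the inverse of a step `Red`. -/
theorem Describes.rauzyMove {q : RowData A} {p : IrrPair A} (hq : q.Describes p) (ε : Fin 2) :
    ∃ q' : RowData A, q'.Describes (IrrPair.rauzyMove ε p) ∧ (q = q' ∨ Red q q' ∨ Red q' q) := by
  obtain ⟨h₀, h₁⟩ := hq
  have hε : ε = 0 ∨ ε = 1 := by fin_cases ε <;> simp
  rcases hε with rfl | rfl
  · obtain ⟨q', e₀, e₁, h⟩ := q.exists_red_of_move h₁.nodup h₀.mem
    have r₀ := Pair.rauzyMove_reads_same h₀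
    have r₁ := Pair.rauzyMove_reads_other (ε := 0) (p := p.1) (u := q.U ++ q.y :: q.S)
      (by simpa [row₀] using h₀) h₁
    exact ⟨q', .of_row_eq r₀ r₁ e₀.symm e₁.symm, h⟩
  · obtain ⟨q', e₁, e₀, h⟩ := q.flip.exists_red_of_move h₀.nodup h₁.mem
    have r₁ := Pair.rauzyMove_reads_same h₁
    have r₀ := Pair.rauzyMove_reads_other (ε := 1) (p := p.1) (u := q.V ++ q.x :: q.T)
      (by simpa [row₁] using h₁) h₀
    refine ⟨q'.flip, .of_row_eq r₀ r₁ e₀.symm e₁.symm, ?_⟩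
    rcases h with rfl | h | h
    · exact .inl rfl
    · exact .inr (.inl h.flip)
    · exact .inr (.inr h.flip)

theorem Describes.standard {q : RowData A} {p : IrrPair A} (hq : q.Describes p)
    (hp : p.1.IsStandard) : q.Standard := by
  obtain ⟨h₀, h₁⟩ := hq
  obtain ⟨-, h, h'⟩ := hp
  have e₀ : p.1.Reads 0 ((q.U ++ q.y :: q.S) ++ q.x :: []) := by simpa [row₀] using h₀
  have e₁ : p.1.Reads 1 ((q.V ++ q.x :: q.T) ++ q.y :: []) := by simpa [row₁] using h₁
  have hx := (h' q.x).2 (by rw [e₀.row_eq, ← e₀.1]; simp [add_assoc])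
  have hy := (h q.y).2 (by rw [e₁.row_eq, ← e₁.1]; simp [add_assoc])
  rw [Pair.Reads.row_eq h₁] at hx
  rw [Pair.Reads.row_eq h₀] at hy
  simpa [Standard] using And.intro hy hx

theorem SwitchEquiv.switchConnected {q q' : RowData A} (h : SwitchEquiv q q') {p r : IrrPair A}
    (hp : q.Describes p) (hr : q'.Describes r) : Pair.SwitchConnected p.1 r.1 := by
  induction h using Relation.ReflTransGen.head_induction_on generalizing p with
  | refl =>
    rw [Pair.eq_of_reads hp.1 hp.2 hr.1 hr.2]
    exact .refl
  | head h _ ih =>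
    obtain ⟨hs, h⟩ := h
    obtain ⟨p', -, hp'⟩ := h.describes hp
    refine .head ?_ (ih hp')
    cases h with
    | intro U V w₁ w₂ w₃ w₄ w₅ w₆ x y b c =>
      obtain ⟨rfl, rfl⟩ := hs
      exact ⟨b, c, y, x, w₁, w₂, w₃, w₄, w₅, w₆, by simpa [row₀] using hp.1,
        by simpa [row₁] using hp.2, by simpa [row₀] using hp'.1, by simpa [row₁] using hp'.2⟩

end RowData

/-! ### Rauzy equivalence compared with switch connectedness. -/

namespace IrrPair

variable {A : Type*} [Fintype A]

open RowData

/-- Stated for all standard forms of both ends, so that transitivity can pass through any standard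
form of the possibly nonstandard middle pair. -/
theorem RauzyEquiv.switchEquiv (hA : 2 ≤ Fintype.card A) {p r : IrrPair A}
    (h : p.RauzyEquiv r) : ∀ {q q' s s' : RowData A}, q.Describes p → q'.Describes r →
      Leads q s → Leads q' s' → SwitchEquiv s s' := by
  induction h with
  | rel p r h =>
    intro q q' s s' hq hq' hs hs'
    obtain ⟨ε, rfl⟩ := h
    obtain ⟨q'', hq'', h⟩ := hq.rauzyMove ε
    obtain rfl := hq''.eq hq'
    rcases h with rfl | h | h
    · exact hs.switchEquiv hs' ⟨p, hq⟩
    · exact hs.switchEquiv (hs'.head h) ⟨p, hq⟩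
    · exact (hs.head h).switchEquiv hs' ⟨_, hq'⟩
  | refl p =>
    intro q q' s s' hq hq' hs hs'
    obtain rfl := hq.eq hq'
    exact hs.switchEquiv hs' ⟨p, hq⟩
  | symm p r _ ih =>
    intro q q' s s' hq hq' hs hs'
    exact (ih hq' hq hs' hs).symm
  | trans p m r _ _ ih ih' =>
    intro q q' s s' hq hq' hs hs'
    obtain ⟨k, hk⟩ := exists_describes m hA
    obtain ⟨l, hl⟩ := Valid.exists_leads ⟨m, hk⟩
    exact (ih hq hk hs hl).trans (ih' hk hq' hl hs')

theorem exists_rauzyEquiv_of_innerSwitch {p : IrrPair A} {q : Pair A} {b c : A}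
    (h : Pair.InnerSwitch b c p.1 q) : ∃ r : IrrPair A, r.1 = q ∧ p.RauzyEquiv r := by
  obtain ⟨a, z, w₁, w₂, w₃, w₄, w₅, w₆, h₀, h₁, h₂, h₃⟩ := h
  obtain ⟨r, hr, hd⟩ := (RelSwitch.intro [] [] w₁ w₂ w₃ w₄ w₅ w₆ z a b c).describes (p := p)
    (.of_row_eq h₀ h₁ (by simp [row₀]) (by simp [row₁]))
  exact ⟨r, Pair.eq_of_reads (by simpa [row₀] using hd.1) (by simpa [row₁] using hd.2)
    (by simpa using h₂) (by simpa using h₃), hr⟩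

theorem exists_rauzyEquiv_of_switchConnected {p : IrrPair A} {q : Pair A}
    (h : Pair.SwitchConnected p.1 q) : ∃ r : IrrPair A, r.1 = q ∧ p.RauzyEquiv r := by
  induction h with
  | refl => exact ⟨p, rfl, .refl p⟩
  | tail _ h ih =>
    obtain ⟨r, rfl, hr⟩ := ih
    obtain ⟨b, c, h⟩ := h
    obtain ⟨r', e, hr'⟩ := exists_rauzyEquiv_of_innerSwitch h
    exact ⟨r', e, .trans _ _ _ hr hr'⟩

end IrrPair

theorem mainTheorem6 {A : Type*} [Fintype A] (p r : IrrPair A)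
    (hp : p.1.IsStandard) (hr : r.1.IsStandard) (hpr : p ≠ r) :
    p.rauzyClass = r.rauzyClass ↔ Pair.SwitchConnected p.1 r.1 := by
  rw [IrrPair.rauzyClass_eq_iff]
  constructor
  · intro h
    -- On at most one letter there is only one pair, against `hpr`.
    have hA : 2 ≤ Fintype.card A := by
      by_contra hA
      refine hpr (Subtype.ext (Pair.ext ?_))
      funext ε b
      have := p.1.one_le ε b
      have := p.1.le_card ε b
      have := r.1.one_le ε b
      have := r.1.le_card ε b
      omega
    obtain ⟨q, hq⟩ := RowData.exists_describes p hA
    obtain ⟨q', hq'⟩ := RowData.exists_describes r hA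
    exact (h.switchEquiv hA hq hq' (hq.standard hp).leads (hq'.standard hr).leads).switchConnected
      hq hq'
  · intro h
    obtain ⟨r', e, hr'⟩ := IrrPair.exists_rauzyEquiv_of_switchConnected h
    obtain rfl := Subtype.ext e
    exact hr'
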